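/- Words and morphisms. Let $\varphi_a,\varphi_b,\varphi_\alpha,\varphi_\beta$ be the morphisms of $\{0,1\}^*$ given by $\varphi_a: 0\mapsto 0,\,1\mapsto 10$; $\ \varphi_b: 0\mapsto 0,\,1\mapsto 01$; $\ \varphi_\alpha: 0\mapsto 01,\,1\mapsto 1$; $\ \varphi_\beta: 0\mapsto 10,\,1\mapsto 1$, and for $w=w_0\cdots w_{n-1}\in\{a,b,\alpha,\beta\}^*$ put $\varphi_w=\varphi_{w_0}\circ\cdots\circ\varphi_{w_{n-1}}$. Order the letters by $a<b$ and $\alpha<\beta$, and let $N(w)$ be the lexicographically greatest word that can be obtained from $w$ by applying (in both directions, inside words) the rewriting rules $\alpha a^k\beta=\beta b^k\alpha$ and $a\alpha^k b=b\beta^k a$, $k\ge 0$. If $\psi=\varphi_w$, then $N(w)$ is called the normalized name of $\psi$. A morphism $\psi$ is primitive if for some $k\ge1$ every letter occurs in $\psi^k(c)$ for every letter $c$. A fixed point of $\psi$ is an infinite word $\mathbf u=u_0u_1u_2\cdots$ with $\psi(u_0)\psi(u_1)\psi(u_2)\cdots=\mathbf u$. For a nonempty word $w=w_0w_1\cdots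 w_{n-1}$ put $\mathrm{cyc}(w)=w_1\cdots w_{n-1}w_0$. Derivated words. For a nonempty prefix $p$ of an infinite word $\mathbf u$, the return words to $p$ are the words $u_iu_{i+1}\cdots u_{j-1}$ with $i<j$ consecutive occurrences of $p$ in $\mathbf u$. If they are $r_0,\dots,r_{k-1}$ (without repetition) and $\mathbf u=r_{s_0}r_{s_1}r_{s_2}\cdots$, then $s_0s_1s_2\cdots$ is the derivated word of $\mathbf u$ with respect to $p$; it is considered up to a permutation of the letters $0,\dots,k-1$. $\mathrm{Der}(\mathbf u)$ denotes the set of derivated words of $\mathbf u$ with respect to its nonempty prefixes; words that differ only by a permutation of letters are identified. Proposition. Let $w\in\{a,\alpha\}^*$ be the normalized name of a primitive morphism $\psi$, and let $a$ be the first letter of $w$. (i) The word $N(wb)$ begins with $b$, and the word $v=b^{-1}N(wb)$, obtained from it by deleting this first letter, belongs to $\{a,\beta\}^*$. The morphism $\psi$ has exactly one fixed point $\mathbf u$ starting with $0$, the morphism $\varphi_v$ has exactly one fixed point $\mathbf v$, and $$\mathrm{Der}(\mathbf u)=\{\mathbf v\}\cup\mathrm{Der}(\mathbf v).$$ (ii)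 Let $v=\mathrm{cyc}(w)$. The morphism $\psi$ has exactly one fixed point $\mathbf u$ starting with $1$, the morphism $\varphi_v$ has exactly one fixed point $\mathbf v$ starting with $1$, and $$\mathrm{Der}(\mathbf u)=\mathrm{Der}(\mathbf v).$$ -/

import Mathlib

namespace SturmDer

/-! ### Words -/

/-- The factor `x_i x_{i+1} ⋯ x_{i+n-1}` of the infinite word `x`. -/
def factor {A : Type*} (x : ℕ → A) (i n : ℕ) : List A :=
  (List.range n).map fun k => x (i + k)

/-- The finite word `w` is a prefix of the infinite word `x`. -/
def IsPrefixOf {A : Type*} (w : List A) (x : ℕ → A) : Prop :=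
  factor x 0 w.length = w

/-- The infinite word `x` is the infinite concatenation `f 0 · f 1 · f 2 ⋯`. The second clause says
that infinitely many letters are produced, so that the concatenation is an infinite word. -/
def IsConcat {A : Type*} (f : ℕ → List A) (x : ℕ → A) : Prop :=
  (∀ m, IsPrefixOf ((List.range m).map f).flatten x) ∧
    ∀ L, ∃ m, L ≤ ((List.range m).map f).flatten.length

/-! ### Morphisms of the free monoid over the alphabet `{0, 1}` -/

/-- Morphisms of the free monoid `{0,1}^*`; multiplication is composition. -/
abbrev Morphism := Monoid.End (FreeMonoid (Fin 2))

/-- The image of a letter, as a list. -/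
def letterImage (ψ : Morphism) (c : Fin 2) : List (Fin 2) :=
  FreeMonoid.toList (ψ (FreeMonoid.of c))

/-- `ψ(u) = x` for infinite words: `x = ψ(u_0) ψ(u_1) ψ(u_2) ⋯`. -/
def IsImage (ψ : Morphism) (u x : ℕ → Fin 2) : Prop :=
  IsConcat (fun i => letterImage ψ (u i)) x

/-- The infinite word `u` is a fixed point of `ψ`. -/
def IsFixedPoint (ψ : Morphism) (u : ℕ → Fin 2) : Prop :=
  IsImage ψ u u

/-- `ψ` is primitive: for some `k ≥ 1` each letter occurs in `ψ^k` of each letter. -/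
def IsPrimitive (ψ : Morphism) : Prop :=
  ∃ k : ℕ, 0 < k ∧ ∀ c d : Fin 2, c ∈ letterImage (ψ ^ k) d

/-- The morphism with `0 ↦ x` and `1 ↦ y`. -/
def morphismOf (x y : List (Fin 2)) : Morphism :=
  FreeMonoid.lift fun c => FreeMonoid.ofList (if c = 0 then x else y)

/-! ### The special Sturmian monoid and names of its elements -/

/-- The letters that name the four elementary Sturmian morphisms. -/
inductive Name
  | a | b | α | β
  deriving DecidableEq

instance : Fintype Name := ⟨{.a, .b, .α, .β}, by intro x; cases x <;> decide⟩

/-- The elementary Sturmian morphisms `φ_a, φ_b, φ_α, φ_β`. -/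
def elem : Name → Morphism
  | .a => morphismOf [0] [1, 0]
  | .b => morphismOf [0] [0, 1]
  | .α => morphismOf [0, 1] [1]
  | .β => morphismOf [1, 0] [1]

/-- `φ_w = φ_{w_0} ∘ φ_{w_1} ∘ ⋯ ∘ φ_{w_{n-1}}`. -/
def phi (w : List Name) : Morphism := (w.map elem).prod

/-- One application, from left to right, of one of the rewriting rules
`α a^k β = β b^k α` and `a α^k b = b β^k a`, `k ≥ 0`, inside a word. -/
inductive Rewrite : List Name → List Name → Prop
  | greek (p s : List Name) (k : ℕ) :
      Rewrite (p ++ (.α :: List.replicate k .a ++ [.β]) ++ s)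
        (p ++ (.β :: List.replicate k .b ++ [.α]) ++ s)
  | latin (p s : List Name) (k : ℕ) :
      Rewrite (p ++ (.a :: List.replicate k .α ++ [.b]) ++ s)
        (p ++ (.b :: List.replicate k .β ++ [.a]) ++ s)

/-- Words obtained from each other by applying the rewriting rules, in both directions, any number
of times. -/
def RewriteEquiv : List Name → List Name → Prop := Relation.EqvGen Rewrite

def Name.rank : Name → ℕ
  | .a => 0
  | .b => 1
  | .α => 2
  | .β => 3

/-- A linear order with `a < b` and `α < β`. How Latin letters compare with Greek ones is
irrelevant: words that are equivalent under the rewriting rules have Latin letters at the same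
positions. -/
instance : LinearOrder Name :=
  LinearOrder.lift' Name.rank (by intro x y; cases x <;> cases y <;> simp [Name.rank])

theorem Rewrite.length_eq {w v : List Name} (h : Rewrite w v) : w.length = v.length := by
  cases h <;> simp

theorem RewriteEquiv.length_eq {w v : List Name} (h : RewriteEquiv w v) :
    w.length = v.length := by
  induction h with
  | rel _ _ h => exact h.length_eq
  | refl _ => rfl
  | symm _ _ _ ih => exact ih.symm
  | trans _ _ _ _ _ ih₁ ih₂ => exact ih₁.trans ih₂

/-- There is a lexicographically greatest word among those equivalent to `w`. -/
theorem exists_isGreatest (w : List Name) : ∃ n, IsGreatest {v | RewriteEquiv w v} n := by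
  have hfin : {v | RewriteEquiv w v}.Finite :=
    (List.finite_length_eq Name w.length).subset fun v hv => hv.length_eq.symm
  obtain ⟨n, hn⟩ := hfin.exists_maximal ⟨w, Relation.EqvGen.refl w⟩
  exact ⟨n, hn.1, fun v hv => (le_total v n).elim id fun h => hn.2 hv h⟩

/-- `N(w)`: the lexicographically greatest word that can be obtained from `w` by applying the
rewriting rules. -/
noncomputable def N (w : List Name) : List Name := Classical.choose (exists_isGreatest w)

theorem N_isGreatest (w : List Name) : IsGreatest {v | RewriteEquiv w v} (N w) :=
  Classical.choose_spec (exists_isGreatest w)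

/-- `w` is the normalized name of `ψ`: `w = N(w')` for a word `w'` with `ψ = φ_{w'}`. -/
def IsNormalizedName (ψ : Morphism) (w : List Name) : Prop :=
  ∃ w', ψ = phi w' ∧ w = N w'

/-! ### Derivated words -/

/-- `i` is an occurrence of `w` in `u`. -/
def IsOccurrence {A : Type*} (u : ℕ → A) (w : List A) (i : ℕ) : Prop :=
  factor u i w.length = w

/-- The return words to `w` in `u`: the words `u_i ⋯ u_{j-1}` for consecutive occurrences `i < j`
of `w`. -/
def returnWords {A : Type*} (u : ℕ → A) (w : List A) : Set (List A) :=
  {r | ∃ i j, i < j ∧ IsOccurrence u w i ∧ IsOccurrence u w j ∧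
    (∀ l, i < l → l < j → ¬ IsOccurrence u w l) ∧ r = factor u i (j - i)}

/-- `d` is a derivated word of `u` with respect to the prefix `w`: the return words can be listed
without repetition as `r_0, …, r_{k-1}` in such a way that `u = r_{d_0} r_{d_1} r_{d_2} ⋯`. The
order of the list is arbitrary, so `d` is determined up to a permutation of the letters
`0, …, k-1`. -/
def IsDerivatedWord {A : Type*} (u : ℕ → A) (w : List A) (d : ℕ → ℕ) : Prop :=
  ∃ (k : ℕ) (r : Fin k ≃ returnWords u w) (s : ℕ → Fin k),
    IsConcat (fun i => (r (s i) : List A)) u ∧ d = fun i => (s i : ℕ)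

/-- `Der(u)`: the derivated words with respect to the nonempty prefixes of `u`. As derivated words
that differ by a permutation of letters are identified, this set contains with a word on `k`
letters all those that arise from it by permuting `0, …, k-1`. -/
def Der {A : Type*} (u : ℕ → A) : Set (ℕ → ℕ) :=
  {d | ∃ w : List A, w ≠ [] ∧ IsPrefixOf w u ∧ IsDerivatedWord u w d}

/-- The set `{v}`, for a binary infinite word `v` considered up to a permutation of the letters
`0, 1`. -/
def permClass (v : ℕ → Fin 2) : Set (ℕ → ℕ) :=
  {d | ∃ σ : Equiv.Perm (Fin 2), d = fun i => (σ (v i) : ℕ)}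

end SturmDer

/-! Write `w = a s`. The derivated words of an infinite word can be compared with those of its
preimage under `φ_a` or `φ_b`, and a fixed point of `ψ` has such a preimage that is itself a fixed
point of a morphism conjugate to `ψ`.

For (i), moving `b` to the left through `w b` turns it into `b v`, where `v` is `s` with every `α`
replaced by `β`, followed by `a`. The rules preserve the morphism, so `ψ φ_b = φ_b φ_v`; hence `φ_b`
maps the fixed point `x` of `φ_v` to a fixed point of `ψ`. It begins with 0, so by uniqueness it is
`u`. For (ii), `φ_a φ_{s a} = φ_{a s} φ_a` plays the same role for the letter 1.

Every 0 in `φ_b(x)` starts a block, so a nonempty prefix of `u = φ_b(x)` occurs only at block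
starts, and it corresponds to a prefix `p` of `x`. Return words correspond under `φ_b`, and the
derivated words agree. The prefix 0 of `u` corresponds to the empty `p`, whose return words are the
single letters: this contributes `x` itself (`Der_image_b`). For `φ_a` and `x` beginning with 1,
block starts are marked by the letter 1 and only nonempty `p` arise (`Der_image_a`).

That `b v` is the normal form follows from two invariants of rewriting: the positions of the Latin
letters, and membership in `{a,α}^* b {a,β}^*` (`N_append_b`). -/

namespace SturmDer

/-! ### Infinite words and their prefixes -/

section Words

variable {A : Type*}

@[simp]
theorem length_factor (x : ℕ → A) (i n : ℕ) : (factor x i n).length = n := by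
  simp [factor]

@[simp]
theorem factor_zero (x : ℕ → A) (i : ℕ) : factor x i 0 = [] := rfl

theorem factor_add (x : ℕ → A) (i m n : ℕ) :
    factor x i (m + n) = factor x i m ++ factor x (i + m) n := by
  simp [factor, List.range_add, add_assoc, Function.comp_def]

theorem factor_one (x : ℕ → A) (i : ℕ) : factor x i 1 = [x i] := by
  simp [factor]

theorem factor_eq_map (f : ℕ → A) (n : ℕ) : (List.range n).map f = factor f 0 n := by
  simp [factor]

/-- The infinite word obtained by deleting the first `i` letters. -/
def drop (x : ℕ → A) (i : ℕ) : ℕ → A := fun k => x (i + k)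

theorem factor_drop (x : ℕ → A) (i j n : ℕ) : factor (drop x i) j n = factor x (i + j) n := by
  simp [factor, drop, add_assoc]

theorem isOccurrence_iff_isPrefixOf_drop {x : ℕ → A} {w : List A} {i : ℕ} :
    IsOccurrence x w i ↔ IsPrefixOf w (drop x i) := by
  rw [IsOccurrence, IsPrefixOf, factor_drop, add_zero]

theorem isPrefixOf_factor (x : ℕ → A) (n : ℕ) : IsPrefixOf (factor x 0 n) x := by
  simp [IsPrefixOf]

theorem factor_prefix_factor (x : ℕ → A) {m n : ℕ} (h : m ≤ n) :
    factor x 0 m <+: factor x 0 n := by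
  obtain ⟨k, rfl⟩ := Nat.exists_eq_add_of_le h
  exact ⟨_, (factor_add x 0 m k).symm⟩

theorem IsPrefixOf.prefix {x : ℕ → A} {v w : List A} (hv : IsPrefixOf v x) (hw : IsPrefixOf w x)
    (h : v.length ≤ w.length) : v <+: w := by
  rw [← hv, ← hw]
  exact factor_prefix_factor x h

theorem IsPrefixOf.of_prefix {x : ℕ → A} {v w : List A} (hw : IsPrefixOf w x) (h : v <+: w) :
    IsPrefixOf v x := by
  have hx := factor_prefix_factor x h.length_le
  rw [hw] at hx
  exact (List.prefix_of_prefix_length_le hx h (by simp)).eq_of_length (by simp)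

theorem isPrefixOf_nil (x : ℕ → A) : IsPrefixOf [] x := rfl

theorem isPrefixOf_singleton {x : ℕ → A} {c : A} : IsPrefixOf [c] x ↔ x 0 = c := by
  simp [IsPrefixOf, factor_one]

theorem IsPrefixOf.head {x : ℕ → A} {c : A} {w : List A} (h : IsPrefixOf (c :: w) x) : x 0 = c :=
  isPrefixOf_singleton.1 (h.of_prefix ⟨w, rfl⟩)

theorem eq_of_common_prefixes {x y : ℕ → A}
    (h : ∀ L, ∃ w : List A, L ≤ w.length ∧ IsPrefixOf w x ∧ IsPrefixOf w y) : x = y := by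
  funext n
  obtain ⟨w, hL, hx, hy⟩ := h (n + 1)
  have e : factor x 0 w.length = factor y 0 w.length := hx.trans hy.symm
  have := congrArg (fun l => l[n]?) e
  simpa [factor, List.getElem?_range (show n < w.length from hL)] using this

/-- An increasing chain of finite words whose lengths tend to infinity has a limit. -/
theorem exists_limit (l : ℕ → List A) (hl : ∀ n, l n <+: l (n + 1))
    (hL : ∀ L, ∃ n, L ≤ (l n).length) : ∃ x : ℕ → A, ∀ n, IsPrefixOf (l n) x := by
  have mono : ∀ m k, l m <+: l (m + k) := fun m k => by
    induction k with
    | zero => exact List.prefix_refl _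
    | succ k ih => exact ih.trans (hl _)
  have comp : ∀ m n k (hm : k < (l m).length) (hn : k < (l n).length), (l m)[k] = (l n)[k] := by
    intro m n k hm hn
    rcases le_total m n with h | h <;> obtain ⟨d, rfl⟩ := Nat.exists_eq_add_of_le h
    · exact (mono m d).getElem hm
    · exact ((mono n d).getElem hn).symm
  choose f hf using fun k => hL (k + 1)
  refine ⟨fun k => (l (f k))[k]'(hf k), fun n => ?_⟩
  refine List.ext_getElem (by simp) fun k h₁ h₂ => ?_
  simp only [factor, List.getElem_map, List.getElem_range, zero_add]
  exact comp _ _ _ _ _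

theorem flatten_range_succ (f : ℕ → List A) (m : ℕ) :
    ((List.range (m + 1)).map f).flatten = ((List.range m).map f).flatten ++ f m := by
  simp [List.range_succ]

theorem le_length_flatten_range {f : ℕ → List A} (hf : ∀ i, f i ≠ []) (m : ℕ) :
    m ≤ ((List.range m).map f).flatten.length := by
  induction m with
  | zero => simp
  | succ m ih =>
    rw [flatten_range_succ, List.length_append]
    have := List.length_pos_iff.2 (hf m)
    omega

theorem isConcat_iff {f : ℕ → List A} (hf : ∀ i, f i ≠ []) {x : ℕ → A} :
    IsConcat f x ↔ ∀ m, IsPrefixOf ((List.range m).map f).flatten x :=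
  ⟨fun h => h.1, fun h => ⟨h, fun L => ⟨L, le_length_flatten_range hf L⟩⟩⟩

theorem exists_isConcat {f : ℕ → List A} (hf : ∀ i, f i ≠ []) : ∃ x, IsConcat f x := by
  obtain ⟨x, hx⟩ := exists_limit (fun m => ((List.range m).map f).flatten)
    (fun m => ⟨f m, (flatten_range_succ f m).symm⟩)
    (fun L => ⟨L, le_length_flatten_range hf L⟩)
  exact ⟨x, (isConcat_iff hf).2 hx⟩

theorem IsPrefixOf.append_iff {x : ℕ → A} {v w : List A} :
    IsPrefixOf (v ++ w) x ↔ IsPrefixOf v x ∧ IsPrefixOf w (drop x v.length) := by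
  constructor
  · intro h
    have hv := h.of_prefix ⟨w, rfl⟩
    refine ⟨hv, ?_⟩
    rw [IsPrefixOf, List.length_append, factor_add, hv, List.append_cancel_left_eq] at h
    rw [IsPrefixOf, factor_drop, ← h]
    simp
  · rintro ⟨hv, hw⟩
    rw [IsPrefixOf, factor_drop, add_zero] at hw
    rw [IsPrefixOf, List.length_append, factor_add, hv, zero_add, hw]

theorem IsConcat.isPrefixOf_drop {f : ℕ → List A} {x : ℕ → A} (h : IsConcat f x) (m : ℕ) :
    IsPrefixOf (f m) (drop x ((List.range m).map f).flatten.length) := by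
  have := h.1 (m + 1)
  rw [flatten_range_succ] at this
  exact (IsPrefixOf.append_iff.1 this).2

theorem IsConcat.eq_singleton {f : ℕ → List A} {x : ℕ → A} (h : IsConcat f x)
    (hf : ∀ i, (f i).length = 1) (m : ℕ) : f m = [x m] := by
  have hm : ((List.range m).map f).flatten.length = m := by
    induction m with
    | zero => simp
    | succ m ih => rw [flatten_range_succ, List.length_append, ih, hf]
  have := h.isPrefixOf_drop m
  rw [hm, IsPrefixOf, factor_drop, hf, factor_one] at this
  exact this.symm

theorem ne_nil_of_mem_returnWords {x : ℕ → A} {w r : List A} (h : r ∈ returnWords x w) :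
    r ≠ [] := by
  obtain ⟨i, j, hij, -, -, -, rfl⟩ := h
  rw [← List.length_pos_iff, length_factor]
  omega

end Words

/-! ### Images under morphisms -/

/-- The action of a morphism on finite words, as lists. -/
def img (φ : Morphism) (w : List (Fin 2)) : List (Fin 2) :=
  FreeMonoid.toList (φ (FreeMonoid.ofList w))

@[simp]
theorem img_nil (φ : Morphism) : img φ [] = [] := by
  change FreeMonoid.toList (φ 1) = []
  rw [map_one]; rfl

@[simp]
theorem img_append (φ : Morphism) (v w : List (Fin 2)) : img φ (v ++ w) = img φ v ++ img φ w := by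
  simp [img, FreeMonoid.ofList_append, FreeMonoid.toList_mul]

theorem img_singleton (φ : Morphism) (c : Fin 2) : img φ [c] = letterImage φ c := rfl

theorem img_cons (φ : Morphism) (c : Fin 2) (w : List (Fin 2)) :
    img φ (c :: w) = letterImage φ c ++ img φ w := by
  rw [← List.singleton_append, img_append, img_singleton]

theorem img_mul (φ χ : Morphism) (w : List (Fin 2)) : img (φ * χ) w = img φ (img χ w) := rfl

theorem img_prefix (φ : Morphism) {v w : List (Fin 2)} (h : v <+: w) : img φ v <+: img φ w := by
  obtain ⟨t, rfl⟩ := h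
  exact ⟨img φ t, (img_append φ v t).symm⟩

theorem flatten_map_letterImage (φ : Morphism) (w : List (Fin 2)) :
    (w.map (letterImage φ)).flatten = img φ w := by
  induction w with
  | nil => simp
  | cons c w ih => rw [List.map_cons, List.flatten_cons, ih, img_cons]

theorem flatten_map_img (φ : Morphism) (l : List (List (Fin 2))) :
    (l.map (img φ)).flatten = img φ l.flatten := by
  induction l with
  | nil => simp
  | cons c w ih => rw [List.map_cons, List.flatten_cons, ih, List.flatten_cons, img_append]

/-- The image of every letter is nonempty. -/
def Nonerasing (φ : Morphism) : Prop := ∀ c, letterImage φ c ≠ []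

theorem Nonerasing.length_le {φ : Morphism} (hφ : Nonerasing φ) (w : List (Fin 2)) :
    w.length ≤ (img φ w).length := by
  induction w with
  | nil => simp
  | cons c w ih =>
    rw [img_cons, List.length_append, List.length_cons]
    have := List.length_pos_iff.2 (hφ c)
    omega

theorem Nonerasing.isImage_iff_factor {φ : Morphism} (hφ : Nonerasing φ) {x u : ℕ → Fin 2} :
    IsImage φ x u ↔ ∀ m, IsPrefixOf (img φ (factor x 0 m)) u := by
  rw [IsImage, isConcat_iff fun i => hφ (x i)]
  refine forall_congr' fun m => ?_
  rw [← flatten_map_letterImage, ← factor_eq_map, List.map_map]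
  rfl

/-- This form lets all later statements about infinite images be checked on finite prefixes. -/
theorem Nonerasing.isImage_iff {φ : Morphism} (hφ : Nonerasing φ) {x u : ℕ → Fin 2} :
    IsImage φ x u ↔ ∀ w, IsPrefixOf w x → IsPrefixOf (img φ w) u := by
  rw [hφ.isImage_iff_factor]
  exact ⟨fun h w hw => hw ▸ h w.length, fun h m => h _ (isPrefixOf_factor x m)⟩

theorem Nonerasing.exists_isImage {φ : Morphism} (hφ : Nonerasing φ) (x : ℕ → Fin 2) :
    ∃ u, IsImage φ x u :=
  exists_isConcat fun i => hφ (x i)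

/-- Every prefix of the image is a prefix of the image of a prefix. -/
theorem Nonerasing.prefix_img {φ : Morphism} (hφ : Nonerasing φ) {x u : ℕ → Fin 2}
    (h : IsImage φ x u) {p : List (Fin 2)} (hp : IsPrefixOf p u) {n : ℕ} (hn : p.length ≤ n) :
    p <+: img φ (factor x 0 n) :=
  hp.prefix (hφ.isImage_iff_factor.1 h n)
    (hn.trans (by simpa using hφ.length_le (factor x 0 n)))

theorem Nonerasing.mul {φ χ : Morphism} (hφ : Nonerasing φ) (hχ : Nonerasing χ) :
    Nonerasing (φ * χ) := fun c h => by
  have := (hφ.length_le (img χ [c]))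
  rw [← img_mul, img_singleton (φ * χ), h, img_singleton] at this
  exact hχ c (List.length_eq_zero_iff.1 (by simpa using this))

theorem IsImage.comp {φ χ : Morphism} (hφ : Nonerasing φ) (hχ : Nonerasing χ)
    {x y z : ℕ → Fin 2} (hy : IsImage χ x y) (hz : IsImage φ y z) : IsImage (φ * χ) x z :=
  (hφ.mul hχ).isImage_iff.2 fun w hw =>
    hφ.isImage_iff.1 hz _ (hχ.isImage_iff.1 hy w hw)

/-- Cancellation on the right: a prefix of `y` of length `n` is covered by the `χ`-image of the
first `n` letters of `x`. It later shows that `φ_b(x)` and `φ_a(x)` are fixed points of `ψ`. -/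
theorem IsImage.of_comp {φ χ : Morphism} (hφ : Nonerasing φ) (hχ : Nonerasing χ)
    {x y z : ℕ → Fin 2} (hy : IsImage χ x y) (hz : IsImage (φ * χ) x z) : IsImage φ y z :=
  hφ.isImage_iff.2 fun w hw =>
    ((hφ.mul hχ).isImage_iff_factor.1 hz w.length).of_prefix
      (img_prefix φ (hχ.prefix_img hy hw le_rfl))

/-- The position in the image at which the block of the `i`-th letter begins. -/
def blockStart (φ : Morphism) (x : ℕ → Fin 2) (i : ℕ) : ℕ := (img φ (factor x 0 i)).length

theorem blockStart_add (φ : Morphism) (x : ℕ → Fin 2) (i n : ℕ) :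
    blockStart φ x (i + n) = blockStart φ x i + (img φ (factor x i n)).length := by
  simp [blockStart, factor_add]

theorem Nonerasing.strictMono_blockStart {φ : Morphism} (hφ : Nonerasing φ) (x : ℕ → Fin 2) :
    StrictMono (blockStart φ x) :=
  strictMono_nat_of_lt_succ fun i => by
    have := hφ.length_le (factor x i 1)
    rw [blockStart_add]
    simp only [length_factor] at this
    omega

theorem IsImage.drop {φ : Morphism} (hφ : Nonerasing φ) {x u : ℕ → Fin 2} (h : IsImage φ x u)
    (i : ℕ) : IsImage φ (drop x i) (drop u (blockStart φ x i)) := by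
  rw [hφ.isImage_iff_factor] at h ⊢
  intro m
  have := h (i + m)
  rw [factor_add, img_append, IsPrefixOf.append_iff, zero_add] at this
  rw [factor_drop, add_zero]
  exact this.2

theorem IsImage.factor_blockStart {φ : Morphism} (hφ : Nonerasing φ) {x u : ℕ → Fin 2}
    (h : IsImage φ x u) (i n : ℕ) :
    factor u (blockStart φ x i) (blockStart φ x (i + n) - blockStart φ x i) =
      img φ (factor x i n) := by
  have := hφ.isImage_iff_factor.1 (h.drop hφ i) n
  rw [factor_drop, add_zero, IsPrefixOf, factor_drop, add_zero] at this
  rw [blockStart_add, Nat.add_sub_cancel_left, this]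

/-- Every position of the image lies in the block of some letter. -/
theorem IsImage.exists_block {φ : Morphism} (hφ : Nonerasing φ) {x u : ℕ → Fin 2}
    (h : IsImage φ x u) (j : ℕ) :
    ∃ i t, j = blockStart φ x i + t ∧ (letterImage φ (x i))[t]? = some (u j) := by
  have hm := hφ.strictMono_blockStart x
  have h0 : blockStart φ x 0 ≤ j := by simp [blockStart]
  obtain ⟨i, hi, hi'⟩ : ∃ i, blockStart φ x i ≤ j ∧ j < blockStart φ x (i + 1) := by
    by_contra! hc
    have : ∀ i, blockStart φ x i ≤ j := fun i => by
      induction i with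
      | zero => exact h0
      | succ i ih => exact hc i ih
    have := (this (j + 1)).trans_lt (Nat.lt_of_succ_le (hm.le_apply (x := j + 1)))
    omega
  obtain ⟨t, rfl⟩ := Nat.exists_eq_add_of_le hi
  refine ⟨i, t, rfl, ?_⟩
  have e := h.factor_blockStart hφ i 1
  rw [factor_one, img_singleton] at e
  rw [← e, factor, List.getElem?_map, List.getElem?_range (by omega)]
  rfl

/-! ### Transfer of derivated words -/

/-- The factorization of an image is determined except possibly for the last letter. -/
def Decodable (φ : Morphism) : Prop :=
  ∀ z c l, img φ (z ++ [c]) <+: img φ l → z <+: l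

theorem Decodable.injective {φ : Morphism} (hφ : Decodable φ) : Function.Injective (img φ) := by
  have key : ∀ y z, img φ y = img φ z → y <+: z := fun y z h => by
    -- Appending 0 and then 1 removes the doubt about the last letter: otherwise `y` would equal
    -- both `z0` and `z1`.
    have h0 := hφ y 0 (z ++ [0]) (by simp [h])
    have h1 := hφ y 1 (z ++ [1]) (by simp [h])
    rw [List.prefix_concat_iff] at h0 h1
    rcases h0 with rfl | h0
    · rcases h1 with h1 | h1
      · simp at h1
      · exact h1
    · exact h0
  exact fun y z h => (key y z h).eq_of_length_le (key z y h.symm).length_le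

theorem isConcat_img_iff {φ : Morphism} (hφ : Nonerasing φ) (hd : Decodable φ) {x u : ℕ → Fin 2}
    (h : IsImage φ x u) {f : ℕ → List (Fin 2)} (hf : ∀ i, f i ≠ []) :
    IsConcat (fun i => img φ (f i)) u ↔ IsConcat f x := by
  have hf' : ∀ i, img φ (f i) ≠ [] := fun i hi => hf i <| by
    have := hφ.length_le (f i)
    rw [hi] at this
    exact List.length_eq_zero_iff.1 (by simpa using this)
  rw [isConcat_iff hf, isConcat_iff hf']
  have e : ∀ m, ((List.range m).map fun i => img φ (f i)).flatten =
      img φ ((List.range m).map f).flatten := fun m => by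
    rw [← flatten_map_img, List.map_map]; rfl
  simp only [e]
  refine ⟨fun H m => ?_, fun H m => hφ.isImage_iff.1 h _ (H m)⟩
  -- Decoding may lose the last letter, so one block more is taken; its first letter is the one
  -- sacrificed.
  have hm := H (m + 1)
  rw [flatten_range_succ] at hm
  obtain ⟨c, t, hc⟩ := List.exists_cons_of_ne_nil (hf m)
  refine (isPrefixOf_factor x _).of_prefix (hd _ c _ (hφ.prefix_img h (hm.of_prefix ?_) le_rfl))
  exact img_prefix φ ⟨t, by simp [hc]⟩

/-- Block starts increase strictly with the index, so consecutive occurrences of `p` are the block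
starts of consecutive occurrences of `w`. -/
theorem returnWords_image {φ : Morphism} (hφ : Nonerasing φ) {x u : ℕ → Fin 2}
    (h : IsImage φ x u) {p w : List (Fin 2)}
    (hocc : ∀ j, IsOccurrence u p j ↔ ∃ i, blockStart φ x i = j ∧ IsOccurrence x w i) :
    returnWords u p = img φ '' returnWords x w := by
  have hm := hφ.strictMono_blockStart x
  have hocc' : ∀ i, IsOccurrence u p (blockStart φ x i) ↔ IsOccurrence x w i := fun i =>
    ⟨fun hi => by obtain ⟨i', e, h'⟩ := (hocc _).1 hi; exact hm.injective e ▸ h',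
      fun hi => (hocc _).2 ⟨i, rfl, hi⟩⟩
  ext r
  constructor
  · rintro ⟨i, j, hij, hi, hj, hl, rfl⟩
    obtain ⟨i, rfl, hi'⟩ := (hocc i).1 hi
    obtain ⟨j, rfl, hj'⟩ := (hocc j).1 hj
    have hij' := hm.lt_iff_lt.1 hij
    refine ⟨factor x i (j - i), ⟨i, j, hij', hi', hj', fun l h₁ h₂ ho => ?_, rfl⟩, ?_⟩
    · exact hl _ (hm h₁) (hm h₂) ((hocc' l).2 ho)
    · rw [← h.factor_blockStart hφ, Nat.add_sub_cancel' hij'.le]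
  · rintro ⟨_, ⟨i, j, hij, hi, hj, hl, rfl⟩, rfl⟩
    refine ⟨_, _, hm hij, (hocc' i).2 hi, (hocc' j).2 hj, fun l h₁ h₂ ho => ?_, ?_⟩
    · obtain ⟨l, rfl, ho'⟩ := (hocc l).1 ho
      exact hl l (hm.lt_iff_lt.1 h₁) (hm.lt_iff_lt.1 h₂) ho'
    · rw [← h.factor_blockStart hφ, Nat.add_sub_cancel' hij.le]

/-- Injectivity of `φ` transports the list of return words, and decodability transports the
factorization, with the same coding sequence `s`. -/
theorem isDerivatedWord_image_iff {φ : Morphism} (hφ : Nonerasing φ) (hd : Decodable φ)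
    {x u : ℕ → Fin 2} (h : IsImage φ x u) {p w : List (Fin 2)}
    (hocc : ∀ j, IsOccurrence u p j ↔ ∃ i, blockStart φ x i = j ∧ IsOccurrence x w i)
    (d : ℕ → ℕ) : IsDerivatedWord u p d ↔ IsDerivatedWord x w d := by
  let e : returnWords x w ≃ returnWords u p :=
    (Equiv.Set.image (img φ) (returnWords x w) hd.injective).trans
      (Equiv.setCongr (returnWords_image hφ h hocc).symm)
  have he : ∀ r, (e r : List (Fin 2)) = img φ r := fun r => rfl
  constructor
  · rintro ⟨k, r, s, hc, rfl⟩
    refine ⟨k, r.trans e.symm, s, ?_, rfl⟩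
    rw [← isConcat_img_iff hφ hd h fun i => ne_nil_of_mem_returnWords (Subtype.prop _)]
    simpa [← he] using hc
  · rintro ⟨k, r, s, hc, rfl⟩
    refine ⟨k, r.trans e, s, ?_, rfl⟩
    rw [← isConcat_img_iff hφ hd h fun i => ne_nil_of_mem_returnWords (Subtype.prop _)] at hc
    simpa [he] using hc

/-! ### The elementary morphisms -/

@[simp]
theorem letterImage_morphismOf (x y : List (Fin 2)) (c : Fin 2) :
    letterImage (morphismOf x y) c = if c = 0 then x else y :=
  congrArg FreeMonoid.toList (FreeMonoid.lift_eval_of (M := FreeMonoid (Fin 2))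
    (fun c => FreeMonoid.ofList (if c = 0 then x else y)) c)

theorem nonerasing_elem (n : Name) : Nonerasing (elem n) := by
  intro c
  cases n <;> simp only [elem, letterImage_morphismOf] <;> split_ifs <;> simp

theorem mem_letterImage_elem (n : Name) (c : Fin 2) : c ∈ letterImage (elem n) c := by
  cases n <;> fin_cases c <;> simp [elem]

@[simp]
theorem img_a_zero (w : List (Fin 2)) : img (elem .a) (0 :: w) = 0 :: img (elem .a) w := by
  simp [img_cons, elem]

@[simp]
theorem img_a_one (w : List (Fin 2)) : img (elem .a) (1 :: w) = 1 :: 0 :: img (elem .a) w := by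
  simp [img_cons, elem]

@[simp]
theorem img_b_zero (w : List (Fin 2)) : img (elem .b) (0 :: w) = 0 :: img (elem .b) w := by
  simp [img_cons, elem]

@[simp]
theorem img_b_one (w : List (Fin 2)) : img (elem .b) (1 :: w) = 0 :: 1 :: img (elem .b) w := by
  simp [img_cons, elem]

@[simp]
theorem img_α_zero (w : List (Fin 2)) : img (elem .α) (0 :: w) = 0 :: 1 :: img (elem .α) w := by
  simp [img_cons, elem]

@[simp]
theorem img_α_one (w : List (Fin 2)) : img (elem .α) (1 :: w) = 1 :: img (elem .α) w := by
  simp [img_cons, elem]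

@[simp]
theorem img_β_zero (w : List (Fin 2)) : img (elem .β) (0 :: w) = 1 :: 0 :: img (elem .β) w := by
  simp [img_cons, elem]

@[simp]
theorem img_β_one (w : List (Fin 2)) : img (elem .β) (1 :: w) = 1 :: img (elem .β) w := by
  simp [img_cons, elem]

theorem forall_letter {P : Fin 2 → Prop} (h0 : P 0) (h1 : P 1) : ∀ c, P c := by
  intro c; fin_cases c
  exacts [h0, h1]

/-! ### Decoding prefixes of words over the codes {0, 10} and {0, 01}. -/

theorem prefix_of_img_a_prefix : ∀ z l, img (elem .a) z <+: img (elem .a) l → z <+: l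
  | [], l => fun _ => List.nil_prefix
  | c :: z, [] => by
    revert c; refine forall_letter ?_ ?_ <;> simp
  | c :: z, d :: l => by
    have ih := prefix_of_img_a_prefix z l
    revert c d; refine forall_letter (forall_letter ?_ ?_) (forall_letter ?_ ?_) <;>
      simp [List.cons_prefix_cons] <;> exact ih

/-- {0, 10} is a prefix code, and a final 1 can only be the start of a block 10. -/
theorem img_a_one_prefix : ∀ z l, img (elem .a) z ++ [1] <+: img (elem .a) l → z ++ [1] <+: l
  | [], [] => by simp
  | [], d :: l => by
    revert d; refine forall_letter ?_ ?_ <;> simp [List.cons_prefix_cons]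
  | c :: z, [] => by
    revert c; refine forall_letter ?_ ?_ <;> simp
  | c :: z, d :: l => by
    have ih := img_a_one_prefix z l
    revert c d; refine forall_letter (forall_letter ?_ ?_) (forall_letter ?_ ?_) <;>
      simp [List.cons_prefix_cons] <;> exact ih

theorem exists_of_prefix_img_a : ∀ p l, p <+: img (elem .a) l →
    ∃ w, p = img (elem .a) w ∨ p = img (elem .a) w ++ [1]
  | [], _ => fun _ => ⟨[], .inl (by simp)⟩
  | c :: p, [] => by simp
  | c :: p, d :: l => by
    revert d; refine forall_letter ?_ ?_
    · rw [img_a_zero, List.cons_prefix_cons]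
      rintro ⟨rfl, h⟩
      obtain ⟨w, rfl | rfl⟩ := exists_of_prefix_img_a p l h
      exacts [⟨0 :: w, by simp⟩, ⟨0 :: w, by simp⟩]
    · rw [img_a_one, List.cons_prefix_cons]
      rintro ⟨rfl, h⟩
      match p with
      | [] => exact ⟨[], by simp⟩
      | e :: p =>
        rw [List.cons_prefix_cons] at h
        obtain ⟨rfl, h⟩ := h
        obtain ⟨w, rfl | rfl⟩ := exists_of_prefix_img_a p l h
        exacts [⟨1 :: w, by simp⟩, ⟨1 :: w, by simp⟩]

/-- {0, 01} is not a prefix code, but every block starts with 0, so a further 0 certifies that the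
preceding block is complete. -/
theorem img_b_zero_prefix : ∀ z l, img (elem .b) z ++ [0] <+: img (elem .b) l → z <+: l
  | [], l => fun _ => List.nil_prefix
  | c :: z, [] => by
    revert c; refine forall_letter ?_ ?_ <;> simp
  | c :: z, d :: l => by
    have ih := img_b_zero_prefix z l
    -- `h0` and `h1` exclude different first letters: after the common 0, one side would continue
    -- with 0 and the other with 1.
    have h0 : ∀ (t s : List (Fin 2)), ¬ img (elem .b) t ++ [0] <+: 1 :: s := fun t s => by
      match t with
      | [] => simp [List.cons_prefix_cons]
      | c :: t => revert c; refine forall_letter ?_ ?_ <;> simp [List.cons_prefix_cons]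
    have h1 : ∀ (t s : List (Fin 2)), ¬ 1 :: t <+: img (elem .b) s := fun t s => by
      match s with
      | [] => simp
      | c :: s => revert c; refine forall_letter ?_ ?_ <;> simp [List.cons_prefix_cons]
    revert c d; refine forall_letter (forall_letter ?_ ?_) (forall_letter ?_ ?_)
    · simpa [List.cons_prefix_cons] using ih
    · simpa [List.cons_prefix_cons] using h0 _ _
    · simpa [List.cons_prefix_cons] using h1 _ _
    · simpa [List.cons_prefix_cons] using ih

theorem img_b_zero_one_prefix : ∀ z l, img (elem .b) z ++ [0, 1] <+: img (elem .b) l →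
    z ++ [1] <+: l
  | [], [] => by simp
  | [], d :: l => by
    have h1 : ∀ (s : List (Fin 2)), ¬ [1] <+: img (elem .b) s := fun s => by
      match s with
      | [] => simp
      | c :: s => revert c; refine forall_letter ?_ ?_ <;> simp [List.cons_prefix_cons]
    revert d; refine forall_letter ?_ ?_
    · simpa [List.cons_prefix_cons] using h1 l
    · simp [List.cons_prefix_cons]
  | c :: z, l => fun h => by
    have hz : c :: z <+: l := img_b_zero_prefix _ _ (.trans ⟨[1], by simp⟩ h)
    obtain ⟨d, l, rfl⟩ : ∃ d l', l = d :: l' := by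
      obtain ⟨t, rfl⟩ := hz
      exact ⟨_, _, rfl⟩
    obtain ⟨rfl, -⟩ := List.cons_prefix_cons.1 hz
    have ih := img_b_zero_one_prefix z l
    rw [img_cons, img_cons, List.append_assoc, List.prefix_append_right_inj] at h
    exact List.cons_prefix_cons.2 ⟨rfl, ih h⟩

/-- The last 0 is split off because it may be a whole block or the start of 01; it also makes the
empty `w` possible for nonempty `p`. -/
theorem exists_of_prefix_img_b : ∀ p l, p ≠ [] → p <+: img (elem .b) l →
    ∃ w, p = img (elem .b) w ++ [0] ∨ p = img (elem .b) w ++ [0, 1]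
  | [], _ => fun h => (h rfl).elim
  | c :: p, [] => by simp
  | c :: p, d :: l => fun _ => by
    revert d; refine forall_letter ?_ ?_
    · rw [img_b_zero, List.cons_prefix_cons]
      rintro ⟨rfl, h⟩
      by_cases hp : p = []
      · exact ⟨[], .inl (by simp [hp])⟩
      obtain ⟨w, rfl | rfl⟩ := exists_of_prefix_img_b p l hp h
      exacts [⟨0 :: w, by simp⟩, ⟨0 :: w, by simp⟩]
    · rw [img_b_one, List.cons_prefix_cons]
      rintro ⟨rfl, h⟩
      match p with
      | [] => exact ⟨[], by simp⟩
      | e :: p =>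
        rw [List.cons_prefix_cons] at h
        obtain ⟨rfl, h⟩ := h
        by_cases hp : p = []
        · exact ⟨[], .inr (by simp [hp])⟩
        obtain ⟨w, rfl | rfl⟩ := exists_of_prefix_img_b p l hp h
        exacts [⟨1 :: w, by simp⟩, ⟨1 :: w, by simp⟩]

theorem decodable_a : Decodable (elem .a) := fun z c l h =>
  prefix_of_img_a_prefix z l (.trans (img_prefix _ ⟨[c], rfl⟩) h)

theorem img_b_zero_prefix_img_b_append (z w : List (Fin 2)) (hw : w ≠ []) :
    img (elem .b) z ++ [0] <+: img (elem .b) (z ++ w) := by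
  obtain ⟨c, t, rfl⟩ := List.exists_cons_of_ne_nil hw
  rw [img_append, List.prefix_append_right_inj]
  revert c; refine forall_letter ?_ ?_ <;> simp [List.cons_prefix_cons]

theorem decodable_b : Decodable (elem .b) := fun z c l h =>
  img_b_zero_prefix z l ((img_b_zero_prefix_img_b_append z [c] (by simp)).trans h)

/-! ### Occurrences in the images under `φ_a` and `φ_b` -/

section Occurrences

variable {x u : ℕ → Fin 2}

theorem isPrefixOf_img_a_iff (h : IsImage (elem .a) x u) (w : List (Fin 2)) :
    IsPrefixOf (img (elem .a) w) u ↔ IsPrefixOf w x :=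
  ⟨fun hw => (isPrefixOf_factor x _).of_prefix
      (prefix_of_img_a_prefix _ _ ((nonerasing_elem _).prefix_img h hw le_rfl)),
    (nonerasing_elem _).isImage_iff.1 h w⟩

theorem isPrefixOf_img_a_one_iff (h : IsImage (elem .a) x u) (w : List (Fin 2)) :
    IsPrefixOf (img (elem .a) w ++ [1]) u ↔ IsPrefixOf (w ++ [1]) x :=
  ⟨fun hw => (isPrefixOf_factor x _).of_prefix
      (img_a_one_prefix _ _ ((nonerasing_elem _).prefix_img h hw le_rfl)),
    fun hw => ((nonerasing_elem _).isImage_iff.1 h _ hw).of_prefix ⟨[0], by simp⟩⟩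

theorem isPrefixOf_img_b_zero_iff (h : IsImage (elem .b) x u) (w : List (Fin 2)) :
    IsPrefixOf (img (elem .b) w ++ [0]) u ↔ IsPrefixOf w x := by
  refine ⟨fun hw => (isPrefixOf_factor x _).of_prefix
      (img_b_zero_prefix _ _ ((nonerasing_elem _).prefix_img h hw le_rfl)), fun hw => ?_⟩
  have := (nonerasing_elem _).isImage_iff_factor.1 h (w.length + 1)
  rw [factor_add, hw] at this
  exact this.of_prefix (img_b_zero_prefix_img_b_append _ _ (by simp [← List.length_pos_iff]))

theorem isPrefixOf_img_b_zero_one_iff (h : IsImage (elem .b) x u) (w : List (Fin 2)) :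
    IsPrefixOf (img (elem .b) w ++ [0, 1]) u ↔ IsPrefixOf (w ++ [1]) x :=
  ⟨fun hw => (isPrefixOf_factor x _).of_prefix
      (img_b_zero_one_prefix _ _ ((nonerasing_elem _).prefix_img h hw le_rfl)),
    fun hw => by simpa using (nonerasing_elem _).isImage_iff.1 h _ hw⟩

/-- If every occurrence of `p` begins at the start of a block, occurrences of `p` in the image can
be found by looking at the beginnings of the suffixes. -/
theorem occurrences_of_prefix {φ : Morphism} (hφ : Nonerasing φ) (h : IsImage φ x u)
    {p w : List (Fin 2)} (hp : ∀ j, IsOccurrence u p j → ∃ i, blockStart φ x i = j)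
    (hpw : ∀ y z, IsImage φ y z → (IsPrefixOf p z ↔ IsPrefixOf w y)) (j : ℕ) :
    IsOccurrence u p j ↔ ∃ i, blockStart φ x i = j ∧ IsOccurrence x w i := by
  constructor
  · intro hj
    obtain ⟨i, rfl⟩ := hp j hj
    rw [isOccurrence_iff_isPrefixOf_drop, hpw _ _ (h.drop hφ i)] at hj
    exact ⟨i, rfl, isOccurrence_iff_isPrefixOf_drop.2 hj⟩
  · rintro ⟨i, rfl, hi⟩
    rw [isOccurrence_iff_isPrefixOf_drop, hpw _ _ (h.drop hφ i)]
    exact isOccurrence_iff_isPrefixOf_drop.1 hi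

theorem exists_blockStart_a (h : IsImage (elem .a) x u) {j : ℕ} (hj : u j = 1) :
    ∃ i, blockStart (elem .a) x i = j := by
  obtain ⟨i, t, rfl, ht⟩ := h.exists_block (nonerasing_elem _) j
  rw [hj] at ht
  refine ⟨i, ?_⟩
  match t with
  | 0 => rfl
  | 1 => simp only [elem, letterImage_morphismOf] at ht; split_ifs at ht <;> simp at ht
  | t + 2 => simp only [elem, letterImage_morphismOf] at ht; split_ifs at ht <;> simp at ht

theorem exists_blockStart_b (h : IsImage (elem .b) x u) {j : ℕ} (hj : u j = 0) :
    ∃ i, blockStart (elem .b) x i = j := by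
  obtain ⟨i, t, rfl, ht⟩ := h.exists_block (nonerasing_elem _) j
  rw [hj] at ht
  refine ⟨i, ?_⟩
  match t with
  | 0 => rfl
  | 1 => simp only [elem, letterImage_morphismOf] at ht; split_ifs at ht <;> simp at ht
  | t + 2 => simp only [elem, letterImage_morphismOf] at ht; split_ifs at ht <;> simp at ht

theorem IsOccurrence.head {p : List (Fin 2)} {j : ℕ} (hj : IsOccurrence u p j) {c : Fin 2}
    (hu : IsPrefixOf p u) (hp : p ≠ []) (hc : u 0 = c) : u j = c := by
  obtain ⟨d, t, rfl⟩ := List.exists_cons_of_ne_nil hp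
  have h1 := hu.head
  have h2 := (isOccurrence_iff_isPrefixOf_drop.1 hj).head
  rw [← hc, h1, ← h2]
  rfl

end Occurrences

/-! ### Derivated words of images -/

/-- Since `u` begins with 1, so does each of its nonempty prefixes, and a 1 in `u` occurs only at a
block start. The prefixes `φ_a(w)` and `φ_a(w)1` have the occurrences of `w` and `w1` respectively.
-/
theorem Der_image_a {x u : ℕ → Fin 2} (h : IsImage (elem .a) x u) (hx : x 0 = 1) :
    Der u = Der x := by
  have hφ := nonerasing_elem .a
  have hu : u 0 = 1 := by
    have := hφ.isImage_iff.1 h [1] (isPrefixOf_singleton.2 hx)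
    rw [img_a_one] at this
    exact this.head
  have key : ∀ p w, p ≠ [] → IsPrefixOf p u →
      (∀ y z, IsImage (elem .a) y z → (IsPrefixOf p z ↔ IsPrefixOf w y)) → ∀ d,
      (IsDerivatedWord u p d ↔ IsDerivatedWord x w d) := fun p w hp hpu hpw d =>
    isDerivatedWord_image_iff hφ decodable_a h
      (occurrences_of_prefix hφ h (fun j hj => exists_blockStart_a h (hj.head hpu hp hu)) hpw) d
  ext d
  constructor
  · rintro ⟨p, hp, hpu, hd⟩
    obtain ⟨w, rfl | rfl⟩ := exists_of_prefix_img_a p _ (hφ.prefix_img h hpu le_rfl)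
    · have hpw := fun y z (hz : IsImage (elem .a) y z) => isPrefixOf_img_a_iff hz w
      exact ⟨w, by rintro rfl; simp at hp, (hpw _ _ h).1 hpu, (key _ _ hp hpu hpw d).1 hd⟩
    · have hpw := fun y z (hz : IsImage (elem .a) y z) => isPrefixOf_img_a_one_iff hz w
      exact ⟨w ++ [1], by simp, (hpw _ _ h).1 hpu, (key _ _ hp hpu hpw d).1 hd⟩
  · rintro ⟨w, hw, hwx, hd⟩
    have hpw := fun y z (hz : IsImage (elem .a) y z) => isPrefixOf_img_a_iff hz w
    have hpu := (hpw _ _ h).2 hwx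
    have hp : img (elem .a) w ≠ [] := fun h0 => hw <| by
      have := hφ.length_le w
      rw [h0] at this
      exact List.length_eq_zero_iff.1 (by simpa using this)
    exact ⟨_, hp, hpu, (key _ _ hp hpu hpw d).2 hd⟩

/-- The prefix `w` may be empty on the right: it is the partner of the prefix 0 of `u`. -/
theorem mem_Der_image_b {x u : ℕ → Fin 2} (h : IsImage (elem .b) x u) (d : ℕ → ℕ) :
    d ∈ Der u ↔ ∃ w, IsPrefixOf w x ∧ IsDerivatedWord x w d := by
  have hφ := nonerasing_elem .b
  have hu : u 0 = 0 :=
    isPrefixOf_singleton.1 ((isPrefixOf_img_b_zero_iff h []).2 (isPrefixOf_nil x))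
  have key : ∀ p w, p ≠ [] → IsPrefixOf p u →
      (∀ y z, IsImage (elem .b) y z → (IsPrefixOf p z ↔ IsPrefixOf w y)) → ∀ d,
      (IsDerivatedWord u p d ↔ IsDerivatedWord x w d) := fun p w hp hpu hpw d =>
    isDerivatedWord_image_iff hφ decodable_b h
      (occurrences_of_prefix hφ h (fun j hj => exists_blockStart_b h (hj.head hpu hp hu)) hpw) d
  constructor
  · rintro ⟨p, hp, hpu, hd⟩
    obtain ⟨w, rfl | rfl⟩ := exists_of_prefix_img_b p _ hp (hφ.prefix_img h hpu le_rfl)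
    · have hpw := fun y z (hz : IsImage (elem .b) y z) => isPrefixOf_img_b_zero_iff hz w
      exact ⟨w, (hpw _ _ h).1 hpu, (key _ _ hp hpu hpw d).1 hd⟩
    · have hpw := fun y z (hz : IsImage (elem .b) y z) => isPrefixOf_img_b_zero_one_iff hz w
      exact ⟨w ++ [1], (hpw _ _ h).1 hpu, (key _ _ hp hpu hpw d).1 hd⟩
  · rintro ⟨w, hwx, hd⟩
    have hpw := fun y z (hz : IsImage (elem .b) y z) => isPrefixOf_img_b_zero_iff hz w
    have hpu := (hpw _ _ h).2 hwx
    exact ⟨_, by simp, hpu, (key _ _ (by simp) hpu hpw d).2 hd⟩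

theorem returnWords_nil (x : ℕ → Fin 2) : returnWords x [] = {r | ∃ i, r = [x i]} := by
  ext r
  constructor
  · rintro ⟨i, j, hij, -, -, hl, rfl⟩
    have : j = i + 1 := by
      by_contra hj
      exact hl (i + 1) (by omega) (by omega) rfl
    subst this
    exact ⟨i, by rw [Nat.add_sub_cancel_left, factor_one]⟩
  · rintro ⟨i, rfl⟩
    exact ⟨i, i + 1, by omega, rfl, rfl, fun l h₁ h₂ => by omega,
      by rw [Nat.add_sub_cancel_left, factor_one]⟩

/-- The empty word occurs everywhere, so its return words are the letters of `x`. As both letters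
occur, a listing of them is a permutation of `{0, 1}`. -/
theorem isDerivatedWord_nil_iff {x : ℕ → Fin 2} (hx : ∀ c, ∃ i, x i = c) (d : ℕ → ℕ) :
    IsDerivatedWord x [] d ↔ d ∈ permClass x := by
  have hr : ∀ c : Fin 2, [c] ∈ returnWords x [] := fun c => by
    obtain ⟨i, rfl⟩ := hx c
    rw [returnWords_nil]
    exact ⟨i, rfl⟩
  let e : Fin 2 ≃ returnWords x [] := Equiv.ofBijective (fun c => ⟨[c], hr c⟩)
    ⟨fun c c' h => by simpa using congrArg Subtype.val h, fun ⟨r, h⟩ => by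
      have h' := h
      rw [returnWords_nil] at h'
      obtain ⟨i, rfl⟩ := h'
      exact ⟨x i, rfl⟩⟩
  have he : ∀ c, (e c : List (Fin 2)) = [c] := fun c => rfl
  have hlen : ∀ r : returnWords x [], (r : List (Fin 2)).length = 1 := fun r => by
    rw [← e.apply_symm_apply r, he]; rfl
  constructor
  · rintro ⟨k, r, s, hc, rfl⟩
    obtain rfl : 2 = k := Fin.equiv_iff_eq.1 ⟨e.trans r.symm⟩
    refine ⟨e.trans r.symm, funext fun i => ?_⟩
    have : r (s i) = e (x i) :=
      Subtype.ext ((hc.eq_singleton (fun i => hlen _) i).trans (he _).symm)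
    simp [← this]
  · rintro ⟨σ, rfl⟩
    refine ⟨2, σ.symm.trans e, fun i => σ (x i), ?_, rfl⟩
    simp only [Equiv.trans_apply, Equiv.symm_apply_apply, he]
    rw [isConcat_iff (by simp)]
    intro m
    have : ((List.range m).map fun i => [x i]).flatten = factor x 0 m := by
      simp only [factor, zero_add, ← List.flatMap_def]
      exact List.map_eq_flatMap.symm
    rw [this]
    exact isPrefixOf_factor x m

theorem Der_image_b {x u : ℕ → Fin 2} (h : IsImage (elem .b) x u) (hx : ∀ c, ∃ i, x i = c) :
    Der u = permClass x ∪ Der x := by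
  ext d
  rw [mem_Der_image_b h, Set.mem_union, ← isDerivatedWord_nil_iff hx]
  constructor
  · rintro ⟨w, hw, hd⟩
    by_cases h0 : w = []
    · exact .inl (h0 ▸ hd)
    · exact .inr ⟨w, h0, hw, hd⟩
  · rintro (hd | ⟨w, -, hw, hd⟩)
    · exact ⟨[], isPrefixOf_nil x, hd⟩
    · exact ⟨w, hw, hd⟩

/-! ### Names -/

theorem phi_nil : phi [] = 1 := rfl

theorem phi_cons (n : Name) (w : List Name) : phi (n :: w) = elem n * phi w := by
  simp [phi]

theorem phi_append (v w : List Name) : phi (v ++ w) = phi v * phi w := by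
  simp [phi]

theorem phi_replicate (k : ℕ) (n : Name) : phi (List.replicate k n) = elem n ^ k := by
  simp [phi]

theorem end_mul_apply (φ χ : Morphism) (w : FreeMonoid (Fin 2)) : (φ * χ) w = φ (χ w) := rfl

/-! ### The rewriting rules as identities between morphisms. -/

theorem pow_apply_of_fix {φ : Morphism} {z : FreeMonoid (Fin 2)} (hz : φ z = z) (k : ℕ) :
    (φ ^ k) z = z := by
  induction k with
  | zero => rfl
  | succ k ih => rw [pow_succ, end_mul_apply, hz, ih]

theorem pow_apply_of_right {φ : Morphism} {z o : FreeMonoid (Fin 2)} (hz : φ z = z)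
    (ho : φ o = o * z) (k : ℕ) : (φ ^ k) o = o * z ^ k := by
  induction k with
  | zero => simp
  | succ k ih =>
    rw [pow_succ, end_mul_apply, ho, map_mul, ih, pow_apply_of_fix hz, mul_assoc, pow_succ]

theorem pow_apply_of_left {φ : Morphism} {z o : FreeMonoid (Fin 2)} (hz : φ z = z)
    (ho : φ o = z * o) (k : ℕ) : (φ ^ k) o = z ^ k * o := by
  induction k with
  | zero => simp
  | succ k ih =>
    rw [pow_succ, end_mul_apply, ho, map_mul, ih, pow_apply_of_fix hz, ← mul_assoc,
      pow_succ']

theorem elem_a_zero : elem .a (FreeMonoid.of 0) = FreeMonoid.of 0 := rfl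
theorem elem_a_one : elem .a (FreeMonoid.of 1) = FreeMonoid.of 1 * FreeMonoid.of 0 := rfl
theorem elem_b_zero : elem .b (FreeMonoid.of 0) = FreeMonoid.of 0 := rfl
theorem elem_b_one : elem .b (FreeMonoid.of 1) = FreeMonoid.of 0 * FreeMonoid.of 1 := rfl
theorem elem_α_zero : elem .α (FreeMonoid.of 0) = FreeMonoid.of 0 * FreeMonoid.of 1 := rfl
theorem elem_α_one : elem .α (FreeMonoid.of 1) = FreeMonoid.of 1 := rfl
theorem elem_β_zero : elem .β (FreeMonoid.of 0) = FreeMonoid.of 1 * FreeMonoid.of 0 := rfl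
theorem elem_β_one : elem .β (FreeMonoid.of 1) = FreeMonoid.of 1 := rfl

/-- The relation behind the two families of rewriting rules. -/
theorem elementary_relation {α β a b : Morphism} {z o : FreeMonoid (Fin 2)}
    (haz : a z = z) (hao : a o = o * z) (hbz : b z = z) (hbo : b o = z * o)
    (hαz : α z = z * o) (hαo : α o = o) (hβz : β z = o * z) (hβo : β o = o) (k : ℕ) :
    (α * (a ^ k * β)) z = (β * (b ^ k * α)) z ∧ (α * (a ^ k * β)) o = (β * (b ^ k * α)) o := by
  simp only [end_mul_apply, hβz, hβo, hαz, hαo, map_mul, map_pow,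
    pow_apply_of_right haz hao, pow_apply_of_left hbz hbo, pow_apply_of_fix haz,
    pow_apply_of_fix hbz]
  -- Both goals reduce to `o (z o)^n = (o z)^n o`, with `n = k + 1` on `z` and `n = k` on `o`.
  constructor
  · rw [mul_assoc o, ← pow_succ, ← mul_assoc (o * z), ← pow_succ', mul_pow_mul]
  · rw [mul_pow_mul]

theorem greek_relation (k : ℕ) :
    elem .α * (elem .a ^ k * elem .β) = elem .β * (elem .b ^ k * elem .α) := by
  have h := elementary_relation elem_a_zero elem_a_one elem_b_zero elem_b_one elem_α_zero
    elem_α_one elem_β_zero elem_β_one k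
  exact FreeMonoid.hom_eq (forall_letter h.1 h.2)

/-- Exchanging 0 and 1 swaps `a` with `α` and `b` with `β`, so the abstract relation applies with `z
= 1` and `o = 0`. -/
theorem latin_relation (k : ℕ) :
    elem .a * (elem .α ^ k * elem .b) = elem .b * (elem .β ^ k * elem .a) := by
  have h := elementary_relation elem_α_one elem_α_zero elem_β_one elem_β_zero elem_a_one
    elem_a_zero elem_b_one elem_b_zero k
  exact FreeMonoid.hom_eq (forall_letter h.2 h.1)

theorem RewriteEquiv.phi_eq {v w : List Name} (h : RewriteEquiv v w) : phi v = phi w := by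
  induction h with
  | rel _ _ h =>
    cases h with
    | greek p s k =>
      have := greek_relation k
      simp only [phi_append, phi_cons, phi_nil, phi_replicate, List.cons_append, mul_one]
      rw [this]
    | latin p s k =>
      have := latin_relation k
      simp only [phi_append, phi_cons, phi_nil, phi_replicate, List.cons_append, mul_one]
      rw [this]
  | refl _ => rfl
  | symm _ _ _ ih => exact ih.symm
  | trans _ _ _ _ _ ih₁ ih₂ => exact ih₁.trans ih₂

/-! ### Invariants of rewriting and the normal form of `w b`. -/

theorem Rewrite.append_left {v w : List Name} (p : List Name) (h : Rewrite v w) :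
    Rewrite (p ++ v) (p ++ w) := by
  cases h with
  | greek q s k => simpa [List.append_assoc] using Rewrite.greek (p ++ q) s k
  | latin q s k => simpa [List.append_assoc] using Rewrite.latin (p ++ q) s k

theorem RewriteEquiv.append_left {v w : List Name} (p : List Name) (h : RewriteEquiv v w) :
    RewriteEquiv (p ++ v) (p ++ w) := by
  induction h with
  | rel _ _ h => exact .rel _ _ (h.append_left p)
  | refl _ => exact .refl _
  | symm _ _ _ ih => exact .symm _ _ ih
  | trans _ _ _ _ _ ih₁ ih₂ => exact .trans _ _ _ ih₁ ih₂

/-- `b ↦ a`, `β ↦ α`. -/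
def Name.left : Name → Name
  | .a => .a
  | .b => .a
  | .α => .α
  | .β => .α

/-- `α ↦ β`. -/
def Name.greekRight : Name → Name
  | .a => .a
  | .b => .b
  | .α => .β
  | .β => .β

theorem RewriteEquiv.map_left_eq {v w : List Name} (h : RewriteEquiv v w) :
    v.map Name.left = w.map Name.left := by
  induction h with
  | rel _ _ h => cases h <;> simp [Name.left]
  | refl _ => rfl
  | symm _ _ _ ih => exact ih.symm
  | trans _ _ _ _ _ ih₁ ih₂ => exact ih₁.trans ih₂

/-- `x` may precede `y` in a word of `{a,α}^* b {a,β}^*`. -/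
def MayPrecede (x y : Name) : Prop :=
  (y = .b ∨ y = .α → x = .a ∨ x = .α) ∧ (x = .b ∨ x = .β → y = .a ∨ y = .β)

theorem mayPrecede_a_right (x : Name) : MayPrecede x .a := by
  cases x <;> simp [MayPrecede]

theorem mayPrecede_β_right (x : Name) : MayPrecede x .β := by
  cases x <;> simp [MayPrecede]

theorem mayPrecede_a_left (y : Name) : MayPrecede .a y := by
  cases y <;> simp [MayPrecede]

theorem mayPrecede_α_left (y : Name) : MayPrecede .α y := by
  cases y <;> simp [MayPrecede]

theorem mayPrecede_b_right (x : Name) : MayPrecede x .b ↔ x = .a ∨ x = .α := by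
  cases x <;> simp [MayPrecede]

theorem mayPrecede_α_right (x : Name) : MayPrecede x .α ↔ x = .a ∨ x = .α := by
  cases x <;> simp [MayPrecede]

theorem mayPrecede_b_left (y : Name) : MayPrecede .b y ↔ y = .a ∨ y = .β := by
  cases y <;> simp [MayPrecede]

theorem mayPrecede_β_left (y : Name) : MayPrecede .β y ↔ y = .a ∨ y = .β := by
  cases y <;> simp [MayPrecede]

/-- The words of `{a,α}^* b {a,β}^*`. -/
def OneB (w : List Name) : Prop := w.Pairwise MayPrecede ∧ .b ∈ w

/-- A Greek rule never applies inside the class: a `b` to the left of the factor forbids `α`, one to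
the right forbids `β`, and `β` may not precede `α`. A Latin rule only shifts the single `b` and
exchanges the `α`s it passes for `β`s. -/
theorem Rewrite.oneB_iff {v w : List Name} (h : Rewrite v w) : OneB v ↔ OneB w := by
  cases h with
  | greek p s k =>
    constructor <;> rintro ⟨h, hb⟩ <;> exfalso
    · simp only [List.mem_append, List.mem_cons, List.mem_replicate, reduceCtorEq, and_false,
        List.not_mem_nil, or_false] at hb
      rw [List.pairwise_append, List.pairwise_append] at h
      rcases hb with hb | hb
      · simpa [mayPrecede_b_left] using h.1.2.2 _ hb .α (by simp)
      · simpa [mayPrecede_b_right] using h.2.2 .β (by simp) _ hb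
    · rw [List.pairwise_append, List.pairwise_append, List.pairwise_append] at h
      simpa [mayPrecede_α_right] using h.1.2.1.2.2 .β (by simp) .α (by simp)
  | latin p s k =>
    simp [OneB, List.pairwise_append, List.pairwise_cons, List.mem_replicate,
      List.pairwise_replicate, mayPrecede_a_right, mayPrecede_β_right, mayPrecede_a_left,
      mayPrecede_α_left, mayPrecede_b_right, mayPrecede_α_right, mayPrecede_b_left,
      mayPrecede_β_left, or_imp, forall_and]
    grind

theorem RewriteEquiv.oneB_iff {v w : List Name} (h : RewriteEquiv v w) : OneB v ↔ OneB w := by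
  induction h with
  | rel _ _ h => exact h.oneB_iff
  | refl _ => rfl
  | symm _ _ _ ih => exact ih.symm
  | trans _ _ _ _ _ ih₁ ih₂ => exact ih₁.trans ih₂

/-- The number `k` counts the `α`s directly after the leading `a`. A further `α` is absorbed into
`k`; at an `a`, the rest is treated first with count 0, which brings `b` right behind `a α^k`. -/
theorem rewriteEquiv_move_b (q : List Name) (hq : ∀ c ∈ q, c = .a ∨ c = .α) (k : ℕ) :
    RewriteEquiv (.a :: List.replicate k .α ++ q ++ [.b])
      (.b :: List.replicate k .β ++ q.map Name.greekRight ++ [.a]) := by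
  induction q generalizing k with
  | nil => exact .rel _ _ (by simpa using Rewrite.latin [] [] k)
  | cons c q ih =>
    have hq' : ∀ c ∈ q, c = .a ∨ c = .α := fun c hc => hq c (List.mem_cons_of_mem _ hc)
    rcases hq c List.mem_cons_self with rfl | rfl
    · have h1 := (ih hq' 0).append_left (.a :: List.replicate k .α)
      have h2 := Rewrite.latin [] (q.map Name.greekRight ++ [.a]) k
      simp only [List.replicate_zero, List.cons_append, List.nil_append, List.append_assoc,
        List.map_cons, Name.greekRight] at h1 h2 ⊢
      exact .trans _ _ _ h1 (.rel _ _ h2)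
    · have := ih hq' (k + 1)
      simpa [List.replicate_succ', Name.greekRight] using this

/-- The greatest word starts with `b`, since an equivalent word does and the first letter stays
Latin. Then `OneB` confines the other letters to `a` and `β`, and the Latin positions determine
them. -/
theorem N_append_b {w : List Name} (hw : ∀ c ∈ w, c = .a ∨ c = .α) :
    N (.a :: w ++ [.b]) = .b :: (w.map Name.greekRight ++ [.a]) := by
  have hmove := rewriteEquiv_move_b w hw 0
  simp only [List.replicate_zero, List.cons_append, List.nil_append] at hmove ⊢
  obtain ⟨hN, hmax⟩ := N_isGreatest (.a :: (w ++ [.b]))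
  have hle := hmax hmove
  have hleft := RewriteEquiv.map_left_eq hN
  have hOne : OneB (N (.a :: (w ++ [.b]))) := by
    refine (RewriteEquiv.oneB_iff hN).1 ⟨List.pairwise_cons.2 ⟨fun y _ => mayPrecede_a_left y,
      List.pairwise_append.2 ⟨?_, List.pairwise_singleton _ _, ?_⟩⟩, by simp⟩
    · refine List.pairwise_iff_forall_sublist.2 fun {x y} hxy => ?_
      rcases hw x (hxy.subset (by simp)) with rfl | rfl
      exacts [mayPrecede_a_left y, mayPrecede_α_left y]
    · intro x hx y hy
      obtain rfl := List.mem_singleton.1 hy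
      exact (mayPrecede_b_right x).2 (hw x hx)
  generalize N (.a :: (w ++ [.b])) = n at *
  match n with
  | [] => simp at hleft
  | c :: s =>
    simp only [List.map_cons, List.cons.injEq, Name.left] at hleft
    obtain ⟨hc, hs⟩ := hleft
    have hcb : c = .b := by
      cases c <;> simp at hc
      · exfalso
        refine absurd hle (not_le.2 (List.Lex.rel ?_))
        decide
      · rfl
    subst hcb
    have hs' : ∀ c ∈ s, c = .a ∨ c = .β := fun c hc =>
      ((List.pairwise_cons.1 hOne.1).1 c hc).2 (.inl rfl)
    congr 1
    have h1 : s = (s.map Name.left).map Name.greekRight := by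
      rw [List.map_map]
      nth_rewrite 1 [← List.map_id s]
      refine List.map_congr_left fun c hc => ?_
      rcases hs' c hc with rfl | rfl <;> rfl
    rw [h1, ← hs]
    simp only [List.map_append, List.map_map, List.map_cons, List.map_nil]
    congr 1
    refine List.map_congr_left fun c hc => ?_
    rcases hw c hc with rfl | rfl <;> rfl

/-! ### Fixed points -/

theorem nonerasing_phi (w : List Name) : Nonerasing (phi w) := by
  induction w with
  | nil => intro c; simp [phi_nil, letterImage]
  | cons n w ih => rw [phi_cons]; exact (nonerasing_elem n).mul ih

theorem mem_img_of_forall {φ : Morphism} (hφ : ∀ c, c ∈ letterImage φ c) {c : Fin 2}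
    {l : List (Fin 2)} (h : c ∈ l) : c ∈ img φ l := by
  obtain ⟨s, t, rfl⟩ := List.append_of_mem h
  simp [img_cons, hφ c]

theorem mem_letterImage_phi (w : List Name) (c : Fin 2) : c ∈ letterImage (phi w) c := by
  induction w with
  | nil => simp [phi_nil, letterImage]
  | cons n w ih =>
    rw [phi_cons, ← img_singleton, img_mul]
    exact mem_img_of_forall (mem_letterImage_elem n) ih

/-- No elementary morphism loses a letter: `c` survives the factors after `n`, yields `d` at `n`,
and `d` survives the factors before it. -/
theorem mem_letterImage_phi_of_mem {w : List Name} {n : Name} (hn : n ∈ w) {c d : Fin 2}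
    (h : d ∈ letterImage (elem n) c) : d ∈ letterImage (phi w) c := by
  obtain ⟨p, s, rfl⟩ := List.append_of_mem hn
  rw [phi_append, phi_cons, ← img_singleton, img_mul, img_mul]
  refine mem_img_of_forall (mem_letterImage_phi p) ?_
  obtain ⟨l, r, e⟩ := List.append_of_mem (mem_letterImage_phi s c)
  rw [img_singleton, e]
  simp [img_cons, h]

/-- If `ψ(c)` begins with `c` and contains another letter, then `ψ` has exactly one fixed point
beginning with `c`. -/
theorem existsUnique_fixedPoint {ψ : Morphism} (hψ : Nonerasing ψ) {c d : Fin 2} (hcd : d ≠ c)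
    (hc : [c] <+: letterImage ψ c) (hd : d ∈ letterImage ψ c) :
    ∃! u, IsFixedPoint ψ u ∧ u 0 = c := by
  obtain ⟨t, ht⟩ := hc
  have ht0 : t ≠ [] := by
    rintro rfl
    rw [← ht] at hd
    simp [hcd] at hd
  -- The fixed point is the limit of `ψ^n(c)`. Each iterate is a prefix of the next and, by
  -- induction, of any fixed point beginning with `c`, which gives uniqueness.
  let l : ℕ → List (Fin 2) := fun n => img (ψ ^ n) [c]
  have hl : ∀ n, l (n + 1) = img ψ (l n) := fun n => by
    simp only [l]
    rw [pow_succ', img_mul]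
  have hpow : ∀ n, Nonerasing (ψ ^ n) := fun n => by
    induction n with
    | zero => intro c; simp [letterImage]
    | succ n ih => rw [pow_succ]; exact ih.mul hψ
  have hl' : ∀ n, l (n + 1) = l n ++ img (ψ ^ n) t := fun n => by
    simp only [l]
    rw [pow_succ, img_mul, img_singleton ψ, ← ht, img_append]
  have hlen : ∀ n, n ≤ (l n).length := fun n => by
    induction n with
    | zero => simp
    | succ n ih =>
      rw [hl', List.length_append]
      have := (hpow n).length_le t
      have := List.length_pos_iff.2 ht0
      omega
  obtain ⟨u, hu⟩ := exists_limit l (fun n => ⟨_, (hl' n).symm⟩) fun L => ⟨L, hlen L⟩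
  refine ⟨u, ⟨hψ.isImage_iff.2 fun w hw => ?_, isPrefixOf_singleton.1 (hu 0)⟩, ?_⟩
  · refine (hu (w.length + 1)).of_prefix ?_
    rw [hl]
    exact img_prefix ψ (hw.prefix (hu _) (hlen _))
  · rintro y ⟨hy, hy0⟩
    have : ∀ n, IsPrefixOf (l n) y := fun n => by
      induction n with
      | zero => exact isPrefixOf_singleton.2 hy0
      | succ n ih => rw [hl]; exact hψ.isImage_iff.1 hy _ ih
    exact eq_of_common_prefixes fun L => ⟨l L, hlen L, this L, hu L⟩

theorem head_img_phi {w : List Name} (hw : ∀ c ∈ w, c = .a ∨ c = .α) (c : Fin 2) :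
    [c] <+: letterImage (phi w) c := by
  induction w with
  | nil => simp [phi_nil, letterImage]
  | cons n w ih =>
    refine List.IsPrefix.trans ?_ (show img (elem n) [c] <+: letterImage (phi (n :: w)) c from ?_)
    · rcases hw n List.mem_cons_self with rfl | rfl <;> revert c <;>
        refine forall_letter ?_ ?_ <;> simp [List.cons_prefix_cons]
    · rw [phi_cons, ← img_singleton, img_mul]
      exact img_prefix _ (ih fun c hc => hw c (List.mem_cons_of_mem _ hc))

/-- Both `φ_a` and `φ_β` keep a leading 1, and `φ_β` makes every nonempty image begin with 1. So one
`β` forces every fixed point to begin with 1. -/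
theorem head_img_phi_right {w : List Name} (hw : ∀ c ∈ w, c = .a ∨ c = .β) :
    [1] <+: letterImage (phi w) 1 ∧ (.β ∈ w → [1] <+: letterImage (phi w) 0) := by
  induction w with
  | nil => simp [phi_nil, letterImage]
  | cons n w ih =>
    obtain ⟨ih1, ih0⟩ := ih fun c hc => hw c (List.mem_cons_of_mem _ hc)
    have h1 : [1] <+: img (elem n) [1] := by
      rcases hw n List.mem_cons_self with rfl | rfl <;> simp [List.cons_prefix_cons]
    simp only [phi_cons, ← img_singleton, img_mul] at ih1 ih0 ⊢
    refine ⟨h1.trans (img_prefix _ ih1), fun hβ => ?_⟩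
    rcases List.mem_cons.1 hβ with rfl | hβ
    · obtain ⟨t, ht⟩ : ∃ t, img (phi w) [0] = t := ⟨_, rfl⟩
      rw [ht]
      match t with
      | [] => exact absurd ht (nonerasing_phi w 0)
      | c :: t => revert c; refine forall_letter ?_ ?_ <;> simp [List.cons_prefix_cons]
    · exact h1.trans (img_prefix _ (ih0 hβ))

/-- Otherwise `w` is a power of `a`, and every power of the morphism fixes 0. -/
theorem IsPrimitive.mem_α {w : List Name} (h : IsPrimitive (phi w))
    (hw : ∀ c ∈ w, c = .a ∨ c = .α) : .α ∈ w := by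
  by_contra hα
  have hw' : w = List.replicate w.length .a := List.eq_replicate_iff.2
    ⟨rfl, fun c hc => (hw c hc).resolve_right fun e => hα (e ▸ hc)⟩
  obtain ⟨k, -, hk⟩ := h
  have h1 := hk 1 0
  rw [hw', phi_replicate, ← pow_mul, letterImage, pow_apply_of_fix elem_a_zero] at h1
  simp at h1

end SturmDer

/-! ### The proposition. -/

theorem proposition3p8 (ψ : SturmDer.Morphism) (w : List SturmDer.Name)
    (hprim : SturmDer.IsPrimitive ψ) (hw : SturmDer.IsNormalizedName ψ w)
    (hletters : ∀ c ∈ w, c = SturmDer.Name.a ∨ c = SturmDer.Name.α)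
    (hhead : w.head? = some SturmDer.Name.a) :
    (∃ v : List SturmDer.Name,
      SturmDer.N (w ++ [SturmDer.Name.b]) = SturmDer.Name.b :: v ∧
      (∀ c ∈ v, c = SturmDer.Name.a ∨ c = SturmDer.Name.β) ∧
      (∃! u : ℕ → Fin 2, SturmDer.IsFixedPoint ψ u ∧ u 0 = 0) ∧
      (∃! x : ℕ → Fin 2, SturmDer.IsFixedPoint (SturmDer.phi v) x) ∧
      ∀ u x : ℕ → Fin 2, SturmDer.IsFixedPoint ψ u → u 0 = 0 →
        SturmDer.IsFixedPoint (SturmDer.phi v) x →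
        SturmDer.Der u = SturmDer.permClass x ∪ SturmDer.Der x) ∧
    ((∃! u : ℕ → Fin 2, SturmDer.IsFixedPoint ψ u ∧ u 0 = 1) ∧
      (∃! x : ℕ → Fin 2, SturmDer.IsFixedPoint (SturmDer.phi (w.rotate 1)) x ∧ x 0 = 1) ∧
      ∀ u x : ℕ → Fin 2, SturmDer.IsFixedPoint ψ u → u 0 = 1 →
        SturmDer.IsFixedPoint (SturmDer.phi (w.rotate 1)) x → x 0 = 1 →
        SturmDer.Der u = SturmDer.Der x) := by
  open SturmDer in
  obtain ⟨w', rfl, hN⟩ := hw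
  have hphi : phi w' = phi w := hN ▸ RewriteEquiv.phi_eq (N_isGreatest w').1
  clear hN
  rw [hphi] at hprim ⊢
  clear hphi w'
  have hα : Name.α ∈ w := hprim.mem_α hletters
  obtain ⟨w, rfl⟩ : ∃ s, w = .a :: s := by
    cases w <;> simp_all
  clear hhead hprim
  have hα' : Name.α ∈ w := by simpa using hα
  have hletters' : ∀ c ∈ w, c = Name.a ∨ c = Name.α := fun c hc =>
    hletters c (List.mem_cons_of_mem _ hc)
  have h0α : (1 : Fin 2) ∈ letterImage (elem .α) 0 := by simp [elem]
  have h1a : (0 : Fin 2) ∈ letterImage (elem .a) 1 := by simp [elem]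
  have uniq : ∀ c : Fin 2, ∃! u, IsFixedPoint (phi (.a :: w)) u ∧ u 0 = c :=
    forall_letter
      (existsUnique_fixedPoint (nonerasing_phi _) (by decide) (head_img_phi hletters 0)
        (mem_letterImage_phi_of_mem hα h0α))
      (existsUnique_fixedPoint (nonerasing_phi _) (by decide) (head_img_phi hletters 1)
        (mem_letterImage_phi_of_mem List.mem_cons_self h1a))
  have hv : ∀ c ∈ w.map Name.greekRight ++ [.a], c = Name.a ∨ c = Name.β := by
    intro c hc
    rcases List.mem_append.1 hc with hc | hc
    · obtain ⟨d, hd, rfl⟩ := List.mem_map.1 hc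
      rcases hletters' d hd with rfl | rfl <;> simp [Name.greekRight]
    · exact .inl (by simpa using hc)
  have hvβ : Name.β ∈ w.map Name.greekRight ++ [.a] :=
    List.mem_append_left _ (List.mem_map.2 ⟨_, hα', rfl⟩)
  have hv0 : (0 : Fin 2) ∈ letterImage (phi (w.map Name.greekRight ++ [.a])) 1 :=
    mem_letterImage_phi_of_mem (by simp) h1a
  have hfix : ∀ y, IsFixedPoint (phi (w.map Name.greekRight ++ [.a])) y → y 0 = 1 := by
    intro y hy
    have h := (nonerasing_phi _).isImage_iff.1 hy [y 0] (isPrefixOf_singleton.2 rfl)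
    rw [img_singleton] at h
    refine isPrefixOf_singleton.1 (h.of_prefix ?_)
    obtain ⟨h1, h0⟩ := head_img_phi_right hv
    exact forall_letter (P := fun c => [1] <+: letterImage _ c) (h0 hvβ) h1 (y 0)
  obtain ⟨x, ⟨hx, hx1⟩, hux⟩ := existsUnique_fixedPoint (nonerasing_phi _) (by decide)
    (head_img_phi_right hv).1 hv0
  have hrot : (Name.a :: w).rotate 1 = w ++ [.a] := by simp
  have hletters_rot : ∀ c ∈ w ++ [.a], c = Name.a ∨ c = Name.α := fun c hc =>
    hletters c (by simpa [or_comm] using hc)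
  refine ⟨⟨w.map Name.greekRight ++ [.a], N_append_b hletters', hv, uniq 0, ?_, ?_⟩,
    uniq 1, ?_, ?_⟩
  · exact ⟨x, hx, fun y hy => hux y ⟨hy, hfix y hy⟩⟩
  · intro u y hu hu0 hy
    obtain ⟨z, hz⟩ := (nonerasing_elem .b).exists_isImage y
    -- The relation `w b = b v`, read as an identity of morphisms; it makes `z = φ_b(y)` a fixed
    -- point of `ψ`, hence equal to `u`.
    have hrel : elem .b * phi (w.map Name.greekRight ++ [.a]) = phi (.a :: w) * elem .b := by
      have := (rewriteEquiv_move_b w hletters' 0).phi_eq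
      simpa [phi_append, phi_cons, phi_nil, mul_assoc] using this.symm
    have hzfix : IsFixedPoint (phi (.a :: w)) z := by
      have h := IsImage.comp (nonerasing_elem .b) (nonerasing_phi _) hy hz
      rw [hrel] at h
      exact hz.of_comp (nonerasing_phi _) (nonerasing_elem .b) h
    have hz0 : z 0 = 0 :=
      isPrefixOf_singleton.1 ((isPrefixOf_img_b_zero_iff hz []).2 (isPrefixOf_nil y))
    obtain rfl := (uniq 0).unique ⟨hu, hu0⟩ ⟨hzfix, hz0⟩
    -- Both letters occur in `y`: it begins with 1, hence with `φ_v(1)`, which contains 0.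
    refine Der_image_b hz (forall_letter ?_ ⟨0, hfix y hy⟩)
    have h1 := (nonerasing_phi _).isImage_iff.1 hy [1] (isPrefixOf_singleton.2 (hfix y hy))
    obtain ⟨l, r, e⟩ := List.append_of_mem hv0
    rw [img_singleton, e, IsPrefixOf.append_iff] at h1
    exact ⟨_, h1.2.head⟩
  · rw [hrot]
    exact existsUnique_fixedPoint (nonerasing_phi _) (by decide) (head_img_phi hletters_rot 1)
      (mem_letterImage_phi_of_mem (by simp) h1a)
  · rw [hrot]
    intro u x hu hu1 hx hx1
    obtain ⟨z, hz⟩ := (nonerasing_elem .a).exists_isImage x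
    have hrel : elem .a * phi (w ++ [.a]) = phi (.a :: w) * elem .a := by
      simp [phi_append, phi_cons, phi_nil, mul_assoc]
    have hzfix : IsFixedPoint (phi (.a :: w)) z := by
      have h := IsImage.comp (nonerasing_elem .a) (nonerasing_phi _) hx hz
      rw [hrel] at h
      exact hz.of_comp (nonerasing_phi _) (nonerasing_elem .a) h
    have hz1 : z 0 = 1 := by
      have := (nonerasing_elem .a).isImage_iff.1 hz [1] (isPrefixOf_singleton.2 hx1)
      rw [img_a_one] at this
      exact this.head
    obtain rfl := (uniq 1).unique ⟨hu, hu1⟩ ⟨hzfix, hz1⟩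
    exact Der_image_a hz hx1
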